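/- Let $G=(V,E)$ be a finite graph, possibly with loops or multiple edges, with nonnegative real edge weights $\lambda=\{\lambda_e\}_{e\in E}$. For $H\subseteq E$ and $v\in V$ let $\deg(H,v)$ be the degree of $v$ in the spanning subgraph $(V,H)$ (loops count twice), and let $\deg(G,v)=\deg(E,v)$. Let $f,g:V\to\mathbb{N}$ satisfy $f(v)\le g(v)\le f(v)+2$ for all $v\in V$, and let $u^{(v)}_k=1$ if $f(v)\le k\le g(v)$ and $u^{(v)}_k=0$ otherwise. Define the key polynomials $$K_v(z)=\sum_{j=0}^{d}\binom{d}{j}u^{(v)}_j z^j,\qquad d=\deg(G,v)\quad(v\in V),$$ and, in variables $x=\{x_v\}_{v\in V}$, $$Z(G,\lambda,u;x)=\sum_{H\subseteq E}\ \prod_{e\in H}\lambda_e\ \prod_{v\in V}u^{(v)}_{\deg(H,v)}\,x_v^{\deg(H,v)}.$$ For $0<\theta\le\pi$ let $S[\theta]=\{z\in\mathbb{C}: z\ne 0,\ |\arg z|<\theta\}$, where $-\pi<\arg z\le\pi$. A complex polynomial is called $S[\theta]$-nonvanishing if it is identically zero or it is nonzero whenever all its variables take values in $S[\theta]$. Then: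 1. each key polynomial $K_v(z)$, $v\in V$, is $S[2\pi/3]$-nonvanishing; 2. $Z(G,\lambda,u;x)$ is $S[\pi/6]$-nonvanishing; 3. the univariate specialization $Z(G,\lambda,u;y^{1/2}\mathbf{1})$, obtained by setting $x_v=y^{1/2}$ for every $v\in V$, is a polynomial in $y$ (independent of the choice of square root), and it is $S[\pi/3]$-nonvanishing. -/

import Mathlib

open scoped Graph

noncomputable section

namespace HeilmannLieb

/-- The open sector `S[θ]` centred on the positive real axis
(`Complex.arg` takes values in `(-π, π]`). -/
def sector (θ : ℝ) : Set ℂ := {z | z ≠ 0 ∧ |Complex.arg z| < θ}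

/-- A multivariate polynomial is `A`-nonvanishing if it is identically zero, or it has no zero
all of whose coordinates lie in `A`. -/
def MvNonvanishing {σ : Type*} (A : Set ℂ) (F : MvPolynomial σ ℂ) : Prop :=
  F = 0 ∨ ∀ z : σ → ℂ, (∀ v, z v ∈ A) → MvPolynomial.eval z F ≠ 0

/-- The same notion for a polynomial in one variable. -/
def Nonvanishing (A : Set ℂ) (F : Polynomial ℂ) : Prop :=
  F = 0 ∨ ∀ z ∈ A, Polynomial.eval z F ≠ 0

variable {α β : Type*} (G : Graph α β)

open Classical in
/-- The degree of the vertex `v` in the spanning subgraph with edge set `H`;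
a loop at `v` is counted twice. -/
def deg (H : Finset E(G)) (v : V(G)) : ℕ :=
  (H.filter fun e => G.Inc e v).card + (H.filter fun e => G.IsLoopAt e v).card

variable [Fintype E(G)]

/-- The degree of `v` in the whole graph. -/
def degG (v : V(G)) : ℕ := deg G Finset.univ v

/-- The key polynomial of the vertex `v`: `K_v(z) = ∑_{j=0}^d (d choose j) u_j^{(v)} z^j`,
with `d = deg(G,v)`. -/
def key (u : V(G) → ℕ → ℂ) (v : V(G)) : Polynomial ℂ :=
  ∑ j ∈ Finset.range (degG G v + 1),
    Polynomial.C (((degG G v).choose j : ℂ) * u v j) * Polynomial.X ^ j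

/-- `Z(G,λ,u;x) = ∑_{H ⊆ E} λ^H u_{deg H} x^{deg H}`. Only the activities `u v k` with
`k ≤ deg(G,v)` occur in it. -/
def Z [Fintype V(G)] (lam : E(G) → ℂ) (u : V(G) → ℕ → ℂ) : MvPolynomial V(G) ℂ :=
  ∑ H : Finset E(G),
    MvPolynomial.C ((∏ e ∈ H, lam e) * ∏ v : V(G), u v (deg G H v)) *
      ∏ v : V(G), MvPolynomial.X v ^ deg G H v

/-- The activities `u_k^{(v)} = 1` if `f(v) ≤ k ≤ g(v)`, and `0` otherwise. -/
def intervalActivity {V : Type*} (f g : V → ℕ) (v : V) (k : ℕ) : ℂ :=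
  if f v ≤ k ∧ k ≤ g v then 1 else 0

end HeilmannLieb

end

/-! ### Zeros in a half-plane: Laguerre and Grace–Walsh–Szegő. -/

namespace HeilmannLieb

open Polynomial

/-! With all activities equal to `1`, the partition function is `∏ (1 + λ_e x_a x_b)` over edges `e
= ab`, which is nonzero when all variables lie in the right half-plane. The true activities are
switched on one vertex at a time. At `v` this replaces `∑ a_j t^j` by `∑ a_j u_j z^j`. If the former
has no zero in the half-plane and `K_v = c ∏ (1 + η X)`, then `grace_halfPlane` makes the latter
nonzero as soon as every `z η` has positive real part (`sum_activity_ne_zero`).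

Since `g ≤ f + 2`, `K_v` is a monomial times a factor of degree at most two, and log-concavity of
binomial coefficients puts each `η` within angle `π/3` of the positive axis
(`binomialPoly_interval_eq`). This gives the sector for `K_v` and leaves `z` the angle `π/2 - π/3 =
π/6`.

Grace's theorem needs `deg(G,v)` factors with `η` in the cone, whereas `K_v` may vanish at `0` or
have smaller degree. Hence `K_v` is perturbed (`exists_admissible_tendsto`), and a Hurwitz argument
(`mvNonvanishing_Z_of_tendsto`) passes to the limit. By the handshake lemma, `Z` on the diagonal is
a polynomial in the square of the variable, which doubles the angle. -/

/-- The inversion of the half-plane `re r ≤ 0` seen from a point `z` with `0 < re z`. -/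
lemma re_mul_normSq_le_re_inv_sub {z r : ℂ} (hz : 0 < z.re) (hr : r.re ≤ 0) :
    z.re * Complex.normSq (1 / (z - r)) ≤ (1 / (z - r)).re := by
  have h : 0 < Complex.normSq (z - r) := by
    rw [Complex.normSq_pos]
    intro h
    have := congrArg Complex.re h
    simp at this
    linarith
  rw [one_div, Complex.normSq_inv, Complex.inv_re, div_eq_mul_inv]
  refine mul_le_mul_of_nonneg_right ?_ (inv_nonneg.2 h.le)
  rw [Complex.sub_re]
  linarith

/-- Convexity of the disc `c |w|² ≤ re w`: it contains the mean of its points. -/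
lemma norm_sq_multiset_sum_le {s : Multiset ℂ} {c : ℝ} (hc : 0 < c)
    (h : ∀ w ∈ s, c * Complex.normSq w ≤ w.re) :
    c * Complex.normSq s.sum ≤ s.card * s.sum.re := by
  have key : ∀ s : Multiset ℂ, (∀ w ∈ s, c * Complex.normSq w ≤ w.re) →
      c * ‖s.sum‖ ^ 2 ≤ s.card * s.sum.re ∧ 0 ≤ s.sum.re := by
    intro s
    induction s using Multiset.induction_on with
    | empty => simp
    | cons w s ih =>
      intro h
      obtain ⟨h1, h2⟩ := ih fun w hw => h w (Multiset.mem_cons_of_mem hw)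
      have h3 := h w (Multiset.mem_cons_self w s)
      have hw : 0 ≤ w.re := le_trans (mul_nonneg hc.le (Complex.normSq_nonneg _)) h3
      rw [Multiset.sum_cons, Multiset.card_cons]
      refine ⟨?_, by simpa using add_nonneg hw h2⟩
      rw [← Complex.normSq_eq_norm_sq] at h1 ⊢
      rw [Complex.normSq_apply] at h1 h3 ⊢
      simp only [Complex.add_re, Complex.add_im]
      push_cast
      set S := s.sum
      set n : ℝ := (s.card : ℝ)
      have hn : 0 ≤ n := Nat.cast_nonneg _
      rcases hn.eq_or_lt with hn0 | hn0
      · have : S = 0 := by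
          have : s.card = 0 := by
            have : (s.card : ℝ) = 0 := hn0.symm
            exact_mod_cast this
          rw [Multiset.card_eq_zero] at this
          simp [S, this]
        rw [this, ← hn0]
        simp
        linarith
      · have e1 : n * (c * ((w.re + S.re) * (w.re + S.re) + (w.im + S.im) * (w.im + S.im)))
            ≤ n * ((n + 1) * (w.re + S.re)) := by
          have a := mul_nonneg hc.le (add_nonneg (sq_nonneg (n * w.re - S.re))
            (sq_nonneg (n * w.im - S.im)))
          have b := mul_le_mul_of_nonneg_left h1 (by positivity : 0 ≤ n + 1)
          have d := mul_le_mul_of_nonneg_left h3 (by positivity : 0 ≤ n * (n + 1))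
          -- The identity `n|w + S|² = n(n+1)|w|² + (n+1)|S|² - |n w - S|²`.
          have e : n * (c * ((w.re + S.re) * (w.re + S.re) + (w.im + S.im) * (w.im + S.im)))
            = n * (n + 1) * (c * (w.re * w.re + w.im * w.im))
              + (n + 1) * (c * (S.re * S.re + S.im * S.im))
              - c * ((n * w.re - S.re) ^ 2 + (n * w.im - S.im) ^ 2) := by ring
          rw [e]
          nlinarith
        exact le_of_mul_le_mul_left e1 hn0
  rw [Complex.normSq_eq_norm_sq]
  exact (key s h).1

/-- Laguerre's theorem for the right half-plane. -/
lemma laguerre_halfPlane {p : ℂ[X]} {d : ℕ} (hd : p.natDegree ≤ d) (hd0 : 0 < d)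
    (hp : ∀ z : ℂ, 0 < z.re → p.eval z ≠ 0) {z ξ : ℂ} (hz : 0 < z.re) (hξ : 0 < ξ.re) :
    d * p.eval z + (ξ - z) * p.derivative.eval z ≠ 0 := by
  intro h
  have hpz := hp z hz
  have hp0 : p ≠ 0 := by rintro rfl; simp at hpz
  have hd0' : (d : ℂ) ≠ 0 := by exact_mod_cast hd0.ne'
  have hs := (IsAlgClosed.splits p).eval_derivative_div_eval_of_ne_zero hpz
  set s := p.roots.map fun r => 1 / (z - r) with hsdef
  have hzξ : ξ - z ≠ 0 := by
    intro h0
    rw [h0] at h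
    simp [hd0', hpz] at h
  -- The logarithmic derivative would be `d / (z - ξ)`; the disc inequality then forces `re ξ ≤ 0`.
  have hsum : s.sum = d * (1 / (z - ξ)) := by
    rw [← hs]
    have : z - ξ ≠ 0 := by rw [← neg_sub]; exact neg_ne_zero.2 hzξ
    field_simp
    linear_combination -h
  have hcard : (s.card : ℝ) ≤ d := by
    rw [Multiset.card_map]
    exact_mod_cast (card_roots' p).trans hd
  have hb := norm_sq_multiset_sum_le (s := s) hz (by
    intro w hw
    obtain ⟨r, hr, rfl⟩ := Multiset.mem_map.1 hw
    refine re_mul_normSq_le_re_inv_sub hz ?_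
    by_contra hr0
    exact hp r (not_le.1 hr0) (isRoot_of_mem_roots hr))
  -- Needed to replace the number of roots by the possibly larger `d`.
  have hre : 0 ≤ s.sum.re := by
    by_contra hneg
    have h1 := mul_nonneg hz.le (Complex.normSq_nonneg s.sum)
    have h2 : (s.card : ℝ) * s.sum.re ≤ 0 :=
      mul_nonpos_of_nonneg_of_nonpos (Nat.cast_nonneg _) (not_le.1 hneg).le
    have h3 : Complex.normSq s.sum = 0 := by
      have : z.re * Complex.normSq s.sum = 0 := le_antisymm (hb.trans h2) h1
      exact (mul_eq_zero.1 this).resolve_left hz.ne'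
    rw [Complex.normSq_eq_zero] at h3
    rw [h3] at hneg
    simp at hneg
  have hb' : z.re * Complex.normSq s.sum ≤ d * s.sum.re :=
    hb.trans (mul_le_mul_of_nonneg_right hcard hre)
  rw [hsum] at hb'
  have hN : 0 < Complex.normSq (z - ξ) := by
    rw [Complex.normSq_pos, ← neg_sub]
    exact neg_ne_zero.2 hzξ
  have hdr : (0 : ℝ) < d := by exact_mod_cast hd0
  rw [Complex.normSq_mul, one_div, Complex.normSq_inv, Complex.normSq_natCast,
    ← Complex.ofReal_natCast, Complex.re_ofReal_mul] at hb'
  rw [Complex.inv_re] at hb'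
  field_simp at hb'
  simp at hb'
  linarith

/-- The polynomial `∑_{j ≤ d} (d choose j) b_j X^j`. -/
noncomputable def binomialPoly (d : ℕ) (b : ℕ → ℂ) : ℂ[X] :=
  ∑ j ∈ Finset.range (d + 1), C ((d.choose j : ℂ) * b j) * X ^ j

lemma coeff_binomialPoly (d : ℕ) (b : ℕ → ℂ) (j : ℕ) :
    (binomialPoly d b).coeff j = (d.choose j : ℂ) * b j := by
  simp only [binomialPoly, finsetSum_coeff, coeff_C_mul_X_pow]
  rw [Finset.sum_ite_eq]
  split_ifs with h
  · rfl
  · rw [Nat.choose_eq_zero_of_lt (by simpa using h)]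
    simp

lemma natDegree_binomialPoly_le (d : ℕ) (b : ℕ → ℂ) : (binomialPoly d b).natDegree ≤ d := by
  rw [natDegree_le_iff_coeff_eq_zero]
  intro j hj
  rw [coeff_binomialPoly, Nat.choose_eq_zero_of_lt hj]
  simp

/-- Pascal's rule. With `derivative_binomialPoly_succ` it turns Laguerre's expression into `(d + 1)`
times the binomial polynomial of `b_j + ξ b_{j+1}`. -/
lemma binomialPoly_succ (d : ℕ) (b : ℕ → ℂ) :
    binomialPoly (d + 1) b = binomialPoly d b + X * binomialPoly d fun j => b (j + 1) := by
  ext j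
  rcases j with _ | j
  · simp [coeff_binomialPoly]
  · rw [coeff_add, coeff_X_mul]
    simp only [coeff_binomialPoly, Nat.choose_succ_succ]
    push_cast
    ring

lemma derivative_binomialPoly_succ (d : ℕ) (b : ℕ → ℂ) :
    derivative (binomialPoly (d + 1) b) =
      C (d + 1 : ℂ) * binomialPoly d fun j => b (j + 1) := by
  ext j
  rw [coeff_derivative, coeff_C_mul]
  simp only [coeff_binomialPoly]
  have := congrArg (Nat.cast (R := ℂ)) (Nat.add_one_mul_choose_eq d j)
  push_cast at this
  linear_combination -b (j + 1) * this

lemma binomialPoly_add_mul (d : ℕ) (b c : ℕ → ℂ) (ξ : ℂ) :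
    binomialPoly d (fun j => b j + ξ * c j) = binomialPoly d b + C ξ * binomialPoly d c := by
  ext j
  rw [coeff_add, coeff_C_mul]
  simp only [coeff_binomialPoly]
  ring

lemma natDegree_prod_one_add_le (s : Multiset ℂ) :
    (s.map fun ξ => 1 + C ξ * X).prod.natDegree ≤ s.card := by
  induction s using Multiset.induction_on with
  | empty => simp
  | cons ξ s ih =>
    rw [Multiset.map_cons, Multiset.prod_cons, Multiset.card_cons, add_comm]
    refine natDegree_mul_le.trans (add_le_add ?_ ih |>.trans_eq (add_comm _ _))
    compute_degree

/-- The theorem of Grace, Walsh and Szegő for the right half-plane. -/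
theorem grace_halfPlane (s : Multiset ℂ) (hs : ∀ ξ ∈ s, 0 < ξ.re) (b : ℕ → ℂ)
    (hb : ∀ z : ℂ, 0 < z.re → (binomialPoly s.card b).eval z ≠ 0) :
    ∑ j ∈ Finset.range (s.card + 1), b j * (s.map fun ξ => 1 + C ξ * X).prod.coeff j ≠ 0 := by
  induction s using Multiset.induction_on generalizing b with
  | empty => simpa [binomialPoly] using hb 1 (by simp)
  | cons ξ s ih =>
    have hξ := hs ξ (Multiset.mem_cons_self _ _)
    rw [Multiset.card_cons] at hb
    -- Removing the factor `1 + ξ X` is dual to replacing `b_j` by `b_j + ξ b_{j+1}`.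
    convert! ih (fun η hη => hs η (Multiset.mem_cons_of_mem hη)) (fun j => b j + ξ * b (j + 1)) ?_
      using 1
    · rw [Multiset.map_cons, Multiset.prod_cons, Multiset.card_cons]
      set Q := (s.map fun ξ => 1 + C ξ * X).prod with hQ
      have h0 : Q.coeff (s.card + 1) = 0 :=
        coeff_eq_zero_of_natDegree_lt (Nat.lt_succ_of_le (natDegree_prod_one_add_le s))
      have e : ∀ j, ((1 + C ξ * X) * Q).coeff j = Q.coeff j + ξ * (X * Q).coeff j := by
        intro j
        rw [add_mul, one_mul, mul_assoc, coeff_add, coeff_C_mul]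
      simp only [e]
      simp only [mul_add, add_mul, Finset.sum_add_distrib]
      congr 1
      · rw [Finset.sum_range_succ, h0]
        simp
      · rw [Finset.sum_range_succ']
        simp only [coeff_X_mul, coeff_X_mul_zero]
        rw [mul_zero, mul_zero, add_zero]
        exact Finset.sum_congr rfl fun j _ => by ring
    · intro z hz h
      refine laguerre_halfPlane (natDegree_binomialPoly_le (s.card + 1) b) (Nat.succ_pos _) hb hz hξ
        ?_
      rw [binomialPoly_add_mul, eval_add, eval_mul, eval_C] at h
      rw [derivative_binomialPoly_succ, binomialPoly_succ]
      simp only [eval_add, eval_mul, eval_C, eval_X]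
      push_cast
      linear_combination (s.card + 1 : ℂ) * h

/-- A polynomial without zeros in a disc is controlled there by its value at the centre. -/
lemma norm_eval_le_of_ne_zero {q : ℂ[X]} {D : ℕ} (hD : q.natDegree ≤ D) {r : ℝ} (hr : 0 < r)
    (hq : ∀ t : ℂ, ‖t‖ < r → q.eval t ≠ 0) (t : ℂ) :
    ‖q.eval t‖ ≤ ‖q.eval 0‖ * (1 + ‖t‖ / r) ^ D := by
  have h1 : (1 : ℝ) ≤ 1 + ‖t‖ / r := by
    have : 0 ≤ ‖t‖ / r := by positivity
    linarith
  have hs := IsAlgClosed.splits q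
  have key : ∀ s : Multiset ℂ, (∀ a ∈ s, r ≤ ‖a‖) →
      ‖(s.map fun a => t - a).prod‖ ≤ ‖(s.map fun a => 0 - a).prod‖ * (1 + ‖t‖ / r) ^ s.card := by
    intro s
    induction s using Multiset.induction_on with
    | empty => simp
    | cons a s ih =>
      intro h
      have ha := h a (Multiset.mem_cons_self _ _)
      have hs := ih fun b hb => h b (Multiset.mem_cons_of_mem hb)
      simp only [Multiset.map_cons, Multiset.prod_cons, Multiset.card_cons, norm_mul, pow_succ]
      have : ‖t - a‖ ≤ ‖0 - a‖ * (1 + ‖t‖ / r) := by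
        rw [zero_sub, norm_neg]
        have h2 : ‖t‖ ≤ ‖a‖ * (‖t‖ / r) := by
          rw [mul_div_assoc', le_div_iff₀ hr, mul_comm]
          exact mul_le_mul_of_nonneg_right ha (norm_nonneg _)
        linarith [norm_sub_le t a]
      calc ‖t - a‖ * ‖(s.map fun a => t - a).prod‖
          ≤ (‖0 - a‖ * (1 + ‖t‖ / r)) *
            (‖(s.map fun a => 0 - a).prod‖ * (1 + ‖t‖ / r) ^ s.card) := by gcongr
        _ = _ := by ring
  rw [hs.eval_eq_prod_roots, hs.eval_eq_prod_roots, norm_mul, norm_mul, mul_assoc]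
  refine mul_le_mul_of_nonneg_left ((key q.roots ?_).trans ?_) (norm_nonneg _)
  · intro a ha
    by_contra h
    exact hq a (not_le.1 h) (isRoot_of_mem_roots ha)
  · exact mul_le_mul_of_nonneg_left (pow_le_pow_right₀ h1 ((card_roots' q).trans hD))
      (norm_nonneg _)

end HeilmannLieb

/-! ### Sectors, the cone and the factorisation of key polynomials. -/

namespace HeilmannLieb

open Polynomial Filter Topology

lemma mem_sector_pi_div_six {z : ℂ} :
    z ∈ sector (Real.pi / 6) ↔ 0 < z.re ∧ √3 * |z.im| < z.re := by
  have hre := Complex.norm_mul_cos_arg z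
  have him := Complex.norm_mul_sin_arg z
  have h3 : 0 < √3 := by positivity
  have hpi := Real.pi_pos
  have e1 : Real.sin (Real.pi / 6 - z.arg) = (Real.cos z.arg - √3 * Real.sin z.arg) / 2 := by
    rw [Real.sin_sub, Real.sin_pi_div_six, Real.cos_pi_div_six]; ring
  have e2 : Real.sin (Real.pi / 6 + z.arg) = (Real.cos z.arg + √3 * Real.sin z.arg) / 2 := by
    rw [Real.sin_add, Real.sin_pi_div_six, Real.cos_pi_div_six]; ring
  constructor
  · rintro ⟨hz, ha⟩
    have hn : 0 < ‖z‖ := norm_pos_iff.2 hz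
    rw [abs_lt] at ha
    have s1 := Real.sin_pos_of_pos_of_lt_pi (x := Real.pi / 6 - z.arg) (by linarith) (by linarith)
    have s2 := Real.sin_pos_of_pos_of_lt_pi (x := Real.pi / 6 + z.arg) (by linarith) (by linarith)
    rw [e1] at s1
    rw [e2] at s2
    have t1 := mul_pos hn s1
    have t2 := mul_pos hn s2
    have u1 : √3 * z.im < z.re := by rw [← hre, ← him]; linarith
    have u2 : -(√3 * z.im) < z.re := by rw [← hre, ← him]; linarith
    refine ⟨by linarith, ?_⟩
    rw [← abs_of_pos h3, ← abs_mul, abs_lt]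
    constructor <;> linarith
  · rintro ⟨h, h'⟩
    have hz : z ≠ 0 := by rintro rfl; simp at h
    have hn : 0 < ‖z‖ := norm_pos_iff.2 hz
    have ha := (Complex.abs_arg_lt_pi_div_two_iff.2 (Or.inl h))
    rw [← abs_of_pos h3, ← abs_mul, abs_lt] at h'
    rw [abs_lt] at ha
    refine ⟨hz, abs_lt.2 ⟨?_, ?_⟩⟩
    · by_contra hc
      have := Real.sin_nonpos_of_nonpos_of_neg_pi_le (x := Real.pi / 6 + z.arg) (by linarith)
        (by linarith)
      rw [e2] at this
      have := mul_nonpos_of_nonneg_of_nonpos hn.le this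
      have e : ‖z‖ * ((Real.cos z.arg + √3 * Real.sin z.arg) / 2) = (z.re + √3 * z.im) / 2 := by
        rw [← hre, ← him]; ring
      linarith
    · by_contra hc
      have := Real.sin_nonpos_of_nonpos_of_neg_pi_le (x := Real.pi / 6 - z.arg) (by linarith)
        (by linarith)
      rw [e1] at this
      have := mul_nonpos_of_nonneg_of_nonpos hn.le this
      have e : ‖z‖ * ((Real.cos z.arg - √3 * Real.sin z.arg) / 2) = (z.re - √3 * z.im) / 2 := by
        rw [← hre, ← him]; ring
      linarith

lemma isOpen_sector_pi_div_six : IsOpen (sector (Real.pi / 6)) := by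
  have : sector (Real.pi / 6) = {z : ℂ | 0 < z.re} ∩ {z : ℂ | √3 * |z.im| < z.re} := by
    ext z
    exact mem_sector_pi_div_six
  rw [this]
  exact (isOpen_lt continuous_const Complex.continuous_re).inter
    (isOpen_lt (by fun_prop) Complex.continuous_re)

lemma pos_of_mem_sector_two_pi_div_three {z : ℂ} (hz : z ∈ sector (2 * Real.pi / 3)) :
    0 < √3 * z.re + |z.im| := by
  obtain ⟨hz, ha⟩ := hz
  have hre := Complex.norm_mul_cos_arg z
  have him := Complex.norm_mul_sin_arg z
  have hn : 0 < ‖z‖ := norm_pos_iff.2 hz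
  have hpi := Real.pi_pos
  rw [abs_lt] at ha
  rcases le_total 0 z.arg with h | h
  · have s1 := Real.sin_pos_of_pos_of_lt_pi (x := Real.pi / 3 + z.arg) (by linarith) (by linarith)
    rw [Real.sin_add, Real.sin_pi_div_three, Real.cos_pi_div_three] at s1
    have t1 := mul_pos hn s1
    have := le_abs_self z.im
    have e : ‖z‖ * (√3 / 2 * Real.cos z.arg + 1 / 2 * Real.sin z.arg) =
        (√3 * z.re + z.im) / 2 := by rw [← hre, ← him]; ring
    linarith
  · have s1 := Real.sin_pos_of_pos_of_lt_pi (x := Real.pi / 3 - z.arg) (by linarith) (by linarith)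
    rw [Real.sin_sub, Real.sin_pi_div_three, Real.cos_pi_div_three] at s1
    have t1 := mul_pos hn s1
    have := neg_le_abs z.im
    have e : ‖z‖ * (√3 / 2 * Real.cos z.arg - 1 / 2 * Real.sin z.arg) =
        (√3 * z.re - z.im) / 2 := by rw [← hre, ← him]; ring
    linarith

/-- The closed sector of angle `π / 3`, without its apex. -/
def cone : Set ℂ := {η | 0 < η.re ∧ |η.im| ≤ √3 * η.re}

lemma ofReal_mem_cone {x : ℝ} (hx : 0 < x) : (x : ℂ) ∈ cone := by
  refine ⟨by simpa, ?_⟩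
  simp
  positivity

/-- The angles add up: `π/6 + π/3 = π/2`. -/
lemma re_mul_pos_of_mem_cone {z η : ℂ} (hz : z ∈ sector (Real.pi / 6)) (hη : η ∈ cone) :
    0 < (z * η).re := by
  rw [mem_sector_pi_div_six] at hz
  obtain ⟨h1, h2⟩ := hz
  obtain ⟨h3, h4⟩ := hη
  rw [Complex.mul_re]
  have h : z.im * η.im ≤ |z.im| * |η.im| := by
    rw [← abs_mul]
    exact le_abs_self _
  have h' := mul_le_mul_of_nonneg_left h4 (abs_nonneg z.im)
  have h'' := mul_lt_mul_of_pos_right h2 h3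
  linarith

/-- The root `-1/η` has argument at least `π - π/3` in absolute value. -/
lemma one_add_mul_ne_zero_of_mem_cone {z η : ℂ} (hz : z ∈ sector (2 * Real.pi / 3))
    (hη : η ∈ cone) : 1 + η * z ≠ 0 := by
  intro h
  have hp := pos_of_mem_sector_two_pi_div_three hz
  obtain ⟨h1, h2⟩ := hη
  have hre := congrArg Complex.re h
  have him := congrArg Complex.im h
  simp at hre him
  have hN : 0 < η.re * η.re + η.im * η.im := by nlinarith [mul_self_nonneg η.im]
  have e1 : (η.re * η.re + η.im * η.im) * z.re = -η.re := by
    linear_combination η.re * hre + η.im * him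
  have e2 : (η.re * η.re + η.im * η.im) * z.im = η.im := by
    linear_combination η.re * him - η.im * hre
  have e3 : (η.re * η.re + η.im * η.im) * |z.im| = |η.im| := by
    rw [← abs_of_pos hN, ← abs_mul, e2]
  have := mul_pos hN hp
  rw [mul_add, e3, mul_left_comm, e1] at this
  linarith

/-- The zeros of a quadratic polynomial with positive coefficients `1, p, q` and `q ≤ p²`. -/
lemma exists_cone_factor {p q : ℝ} (hp : 0 < p) (hq : 0 < q) (hpq : q ≤ p ^ 2) :
    ∃ η ∈ cone, ∃ η' ∈ cone, η + η' = (p : ℂ) ∧ η * η' = (q : ℂ) := by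
  rcases le_total (4 * q) (p ^ 2) with h | h
  · have hs := Real.sq_sqrt (sub_nonneg.2 h)
    have h0 := Real.sqrt_nonneg (p ^ 2 - 4 * q)
    set r := √(p ^ 2 - 4 * q)
    have hr : r < p := by nlinarith
    refine ⟨_, ofReal_mem_cone (x := (p + r) / 2) (by linarith), _,
      ofReal_mem_cone (x := (p - r) / 2) (by linarith), ?_, ?_⟩
    · push_cast
      ring
    · rw [← Complex.ofReal_mul]
      congr 1
      nlinarith
  · have hs := Real.sq_sqrt (sub_nonneg.2 h)
    have h0 := Real.sqrt_nonneg (4 * q - p ^ 2)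
    -- Equivalent to `q ≤ p²`: the conjugate pair has argument at most `π/3`.
    have hle : √(4 * q - p ^ 2) ≤ √3 * p := by
      rw [Real.sqrt_le_left (by positivity), mul_pow, Real.sq_sqrt (by norm_num)]
      linarith
    set r := √(4 * q - p ^ 2)
    refine ⟨⟨p / 2, r / 2⟩, ⟨by simpa, ?_⟩, ⟨p / 2, -(r / 2)⟩, ⟨by simpa, ?_⟩, ?_, ?_⟩
    · simp only
      rw [abs_of_nonneg (by linarith)]
      linarith
    · simp only
      rw [abs_neg, abs_of_nonneg (by linarith)]
      linarith
    · apply Complex.ext <;> simp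
    · apply Complex.ext <;> simp
      · nlinarith
      · ring

/-- Supplies `q ≤ p²` for the quadratic factor of a key polynomial. -/
lemma choose_mul_choose_add_two_le (n k : ℕ) :
    n.choose k * n.choose (k + 2) ≤ n.choose (k + 1) ^ 2 := by
  rcases le_or_gt (k + 2) n with h | h
  · obtain ⟨m, rfl⟩ := Nat.exists_eq_add_of_le h
    have h1 := Nat.choose_succ_right_eq (k + 2 + m) k
    have h2 := Nat.choose_succ_right_eq (k + 2 + m) (k + 1)
    rw [show k + 2 + m - k = m + 2 by omega] at h1
    rw [show k + 2 + m - (k + 1) = m + 1 by omega] at h2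
    set a := (k + 2 + m).choose k
    set b := (k + 2 + m).choose (k + 1)
    set c := (k + 2 + m).choose (k + 2)
    have h3 : a * c * ((k + 2) * (m + 2)) = b ^ 2 * ((k + 1) * (m + 1)) := by
      calc a * c * ((k + 2) * (m + 2)) = (a * (m + 2)) * (c * (k + 1 + 1)) := by ring
        _ = _ := by rw [← h1, h2]; ring
    refine le_of_mul_le_mul_right (h3.trans_le ?_) (by positivity : 0 < (k + 2) * (m + 2))
    gcongr <;> omega
  · rw [Nat.choose_eq_zero_of_lt h]
    simp

/-- The shape of the key polynomial of an interval of at most three degrees. -/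
lemma binomialPoly_interval_eq {d f g : ℕ} (hfd : f ≤ d) (hfg : f ≤ g) (hgf : g ≤ f + 2) :
    ∃ (c : ℂ) (s : Multiset ℂ), c ≠ 0 ∧ f + s.card ≤ d ∧ (∀ η ∈ s, η ∈ cone) ∧
      binomialPoly d (fun j => if f ≤ j ∧ j ≤ g then 1 else 0) =
        C c * X ^ f * (s.map fun η => 1 + C η * X).prod := by
  have h0 : 0 < d.choose f := Nat.choose_pos hfd
  have h0' : (d.choose f : ℂ) ≠ 0 := by exact_mod_cast h0.ne'
  have h0r : (0 : ℝ) < d.choose f := by exact_mod_cast h0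
  have shape : binomialPoly d (fun j => if f ≤ j ∧ j ≤ g then 1 else 0) =
      (C (d.choose f : ℂ) + C (if f + 1 ≤ g then (d.choose (f + 1) : ℂ) else 0) * X +
        C (if f + 2 ≤ g then (d.choose (f + 2) : ℂ) else 0) * X ^ 2) * X ^ f := by
    ext j
    rw [coeff_binomialPoly, coeff_mul_X_pow']
    rcases lt_or_ge j f with hj | hj
    · rw [if_neg (by omega), if_neg (by omega), mul_zero]
    · obtain ⟨i, rfl⟩ := Nat.exists_eq_add_of_le hj
      rw [if_pos hj, Nat.add_sub_cancel_left]
      rcases i with _ | _ | _ | i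
      · simp [hfg]
      · simp [coeff_C]
      · simp
      · rw [if_neg (by omega)]
        simp
  rw [shape]
  -- The factor beside `X ^ f` has degree 0, 1 or 2, cut off by `g` or by `d`.
  have hcases : (¬ (f + 1 ≤ g ∧ f + 1 ≤ d)) ∨ (f + 1 ≤ g ∧ f + 1 ≤ d ∧ ¬ (f + 2 ≤ g ∧ f + 2 ≤ d)) ∨
      (f + 2 ≤ g ∧ f + 2 ≤ d) := by omega
  have hz : ∀ i, ¬ (f + i ≤ g ∧ f + i ≤ d) →
      (if f + i ≤ g then (d.choose (f + i) : ℂ) else 0) = 0 := by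
    intro i hi
    split_ifs with h
    · rw [Nat.choose_eq_zero_of_lt (by omega), Nat.cast_zero]
    · rfl
  rcases hcases with h | ⟨h1, h2, h⟩ | ⟨h1, h2⟩
  · refine ⟨d.choose f, 0, h0', by simpa, by simp, ?_⟩
    rw [hz 1 h, hz 2 (by omega)]
    simp
  · have hp : (0 : ℝ) < d.choose (f + 1) := by exact_mod_cast Nat.choose_pos h2
    refine ⟨d.choose f, {(((d.choose (f + 1) : ℝ) / (d.choose f : ℝ) : ℝ) : ℂ)}, h0', by simpa, ?_,
      ?_⟩
    · intro η hη
      rw [Multiset.mem_singleton] at hη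
      rw [hη]
      exact ofReal_mem_cone (by positivity)
    · rw [hz 2 h, if_pos h1, Multiset.map_singleton, Multiset.prod_singleton]
      have : (C (d.choose (f + 1) : ℂ) : ℂ[X]) = C (d.choose f : ℂ) *
          C (((d.choose (f + 1) : ℝ) / (d.choose f : ℝ) : ℝ) : ℂ) := by
        rw [← C_mul]
        congr 1
        push_cast
        field_simp
      rw [this, C_0]
      ring
  · have hp : (0 : ℝ) < d.choose (f + 1) := by exact_mod_cast Nat.choose_pos (by omega)
    have hq : (0 : ℝ) < d.choose (f + 2) := by exact_mod_cast Nat.choose_pos h2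
    obtain ⟨η, hη, η', hη', hadd, hmul⟩ := exists_cone_factor
      (p := (d.choose (f + 1) : ℝ) / (d.choose f : ℝ))
      (q := (d.choose (f + 2) : ℝ) / (d.choose f : ℝ)) (by positivity) (by positivity) (by
        rw [div_pow, div_le_div_iff₀ h0r (by positivity)]
        have : (d.choose f * d.choose (f + 2) : ℝ) ≤ d.choose (f + 1) ^ 2 := by
          exact_mod_cast choose_mul_choose_add_two_le d f
        nlinarith)
    refine ⟨d.choose f, {η, η'}, h0', by simpa, ?_, ?_⟩
    · intro ζ hζ
      rw [Multiset.insert_eq_cons, Multiset.mem_cons, Multiset.mem_singleton] at hζ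
      rcases hζ with rfl | rfl <;> assumption
    · rw [if_pos h1, if_pos (by omega), Multiset.insert_eq_cons, Multiset.map_cons,
        Multiset.map_singleton, Multiset.prod_cons, Multiset.prod_singleton]
      have e1 : (C (d.choose (f + 1) : ℂ) : ℂ[X]) = C (d.choose f : ℂ) * (C η + C η') := by
        rw [← C_add, ← C_mul, hadd]
        congr 1
        push_cast
        field_simp
      have e2 : (C (d.choose (f + 2) : ℂ) : ℂ[X]) = C (d.choose f : ℂ) * (C η * C η') := by
        rw [← C_mul, ← C_mul, hmul]
        congr 1
        push_cast
        field_simp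
      rw [e1, e2]
      ring

/-! ### Admissible activities and perturbation. -/

/-- The key polynomial of the activities `u` in degree `d` has degree `d` and all its zeros `z`
satisfy `-1 / z ∈ cone`. -/
def Admissible (d : ℕ) (u : ℕ → ℂ) : Prop :=
  ∃ (c : ℂ) (s : Multiset ℂ), c ≠ 0 ∧ s.card = d ∧ (∀ η ∈ s, η ∈ cone) ∧
    binomialPoly d u = C c * (s.map fun η => 1 + C η * X).prod

lemma tendsto_coeff_perturb (f n : ℕ) (R : ℂ[X]) (j : ℕ) :
    Tendsto (fun ε : ℝ => ((X + C (ε : ℂ)) ^ f * (1 + C (ε : ℂ) * X) ^ n * R).coeff j)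
      (𝓝[>] 0) (𝓝 ((X ^ f * R).coeff j)) := by
  -- The inner variable plays the role of `ε`, so each coefficient is a polynomial in `ε`.
  set A : ℂ[X][X] := (X + C X) ^ f * (1 + C X * X) ^ n * R.map C with hA
  have e : ∀ ε : ℂ, ((X + C ε) ^ f * (1 + C ε * X) ^ n * R).coeff j = (A.coeff j).eval ε := by
    intro ε
    have : (X + C ε) ^ f * (1 + C ε * X) ^ n * R = A.map (evalRingHom ε) := by
      have hR : (R.map C).map (evalRingHom ε) = R := by
        rw [Polynomial.map_map]
        convert! Polynomial.map_id
        ext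
        simp
      simp [hA, hR]
    rw [this, coeff_map, coe_evalRingHom]
  have h0 := e 0
  simp only [C_0, add_zero, zero_mul, one_pow, mul_one] at h0
  rw [h0]
  simp_rw [e]
  have hc : Continuous fun ε : ℝ => (A.coeff j).eval (ε : ℂ) := by fun_prop
  have := hc.tendsto 0
  rw [Complex.ofReal_zero] at this
  exact this.mono_left nhdsWithin_le_nhds

/-- The zero at `0` moves to `-ε`, and factors `1 + ε X` restore the missing degree. -/
lemma exists_admissible_tendsto {d f g : ℕ} (hfd : f ≤ d) (hfg : f ≤ g) (hgf : g ≤ f + 2) :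
    ∃ U : ℝ → ℕ → ℂ, (∀ ε, 0 < ε → Admissible d (U ε)) ∧
      ∀ j ≤ d, Tendsto (fun ε => U ε j) (𝓝[>] 0) (𝓝 (if f ≤ j ∧ j ≤ g then 1 else 0)) := by
  obtain ⟨c, s, hc, hcard, hs, hpoly⟩ := binomialPoly_interval_eq hfd hfg hgf
  set R : ℂ[X] := C c * (s.map fun η => 1 + C η * X).prod with hR
  set K : ℝ → ℂ[X] := fun ε => (X + C (ε : ℂ)) ^ f * (1 + C (ε : ℂ) * X) ^ (d - (f + s.card)) * R
    with hK
  have hch : ∀ j ≤ d, (d.choose j : ℂ) ≠ 0 := fun j hj => by exact_mod_cast (Nat.choose_pos hj).ne'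
  refine ⟨fun ε j => (K ε).coeff j / d.choose j, ?_, ?_⟩
  · intro ε hε
    have hε0 : (ε : ℂ) ≠ 0 := by exact_mod_cast hε.ne'
    -- `X + ε = ε (1 + ε⁻¹ X)` accounts for the copies of `ε⁻¹`.
    set S : Multiset ℂ := Multiset.replicate f ((ε⁻¹ : ℝ) : ℂ) +
      Multiset.replicate (d - (f + s.card)) (ε : ℂ) + s with hS
    have hScard : S.card = d := by
      simp [hS]
      omega
    have hKS : K ε = C (c * (ε : ℂ) ^ f) * (S.map fun η => 1 + C η * X).prod := by
      have : (X + C (ε : ℂ) : ℂ[X]) = C (ε : ℂ) * (1 + C ((ε⁻¹ : ℝ) : ℂ) * X) := by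
        rw [mul_add, mul_one, ← mul_assoc, ← C_mul, Complex.ofReal_inv, mul_inv_cancel₀ hε0, C_1]
        ring
      simp only [hK, hR, hS, Multiset.map_add, Multiset.prod_add, Multiset.map_replicate,
        Multiset.prod_replicate]
      rw [this, mul_pow, C_mul, C_pow]
      ring
    refine ⟨c * (ε : ℂ) ^ f, S, mul_ne_zero hc (pow_ne_zero _ hε0), hScard, ?_, ?_⟩
    · intro η hη
      rw [hS, Multiset.mem_add, Multiset.mem_add] at hη
      rcases hη with (hη | hη) | hη
      · rw [Multiset.eq_of_mem_replicate hη]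
        exact ofReal_mem_cone (inv_pos.2 hε)
      · rw [Multiset.eq_of_mem_replicate hη]
        exact ofReal_mem_cone hε
      · exact hs η hη
    · rw [← hKS]
      ext j
      rw [coeff_binomialPoly]
      rcases le_or_gt j d with hj | hj
      · field_simp [hch j hj]
      · rw [Nat.choose_eq_zero_of_lt hj, hKS, coeff_C_mul, coeff_eq_zero_of_natDegree_lt
          ((natDegree_prod_one_add_le S).trans_lt (by omega))]
        simp
  · intro j hj
    have h := (tendsto_coeff_perturb f (d - (f + s.card)) R j).div_const (d.choose j : ℂ)
    have e : (X ^ f * R).coeff j = d.choose j * (if f ≤ j ∧ j ≤ g then 1 else 0 : ℂ) := by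
      rw [← coeff_binomialPoly d (fun j => if f ≤ j ∧ j ≤ g then 1 else 0), hpoly, hR]
      congr 1
      ring
    rw [e, mul_div_cancel_left₀ _ (hch j hj)] at h
    exact h

/-- Multiplying the coefficients of a polynomial without zeros in the right half-plane by
admissible activities. -/
lemma sum_activity_ne_zero {d : ℕ} {u a : ℕ → ℂ} (hu : Admissible d u)
    (ha : ∀ t : ℂ, 0 < t.re → ∑ j ∈ Finset.range (d + 1), a j * t ^ j ≠ 0) {z : ℂ}
    (hz : z ∈ sector (Real.pi / 6)) :
    ∑ j ∈ Finset.range (d + 1), a j * u j * z ^ j ≠ 0 := by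
  obtain ⟨c, s, hc, rfl, hs, hpoly⟩ := hu
  have hch : ∀ j ∈ Finset.range (s.card + 1), (s.card.choose j : ℂ) ≠ 0 := fun j hj => by
    exact_mod_cast (Nat.choose_pos (Nat.lt_succ_iff.1 (Finset.mem_range.1 hj))).ne'
  have h := grace_halfPlane (s.map fun η => z * η) (by
    intro ξ hξ
    obtain ⟨η, hη, rfl⟩ := Multiset.mem_map.1 hξ
    exact re_mul_pos_of_mem_cone hz (hs η hη)) (fun j => a j / s.card.choose j) (by
    intro t ht
    rw [Multiset.card_map]
    convert! ha t ht using 1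
    rw [binomialPoly, eval_finsetSum]
    refine Finset.sum_congr rfl fun j hj => ?_
    have := hch j hj
    rw [eval_mul, eval_C, eval_pow, eval_X, mul_div_cancel₀ _ this])
  -- Up to `c`, this is the key polynomial at `z X`, with coefficients `(d choose j) u_j z^j`.
  have hscale : (((s.map fun η => z * η)).map fun ξ => 1 + C ξ * X).prod =
      (s.map fun η => 1 + C η * X).prod.comp (C z * X) := by
    rw [Multiset.map_map, Polynomial.multiset_prod_comp, Multiset.map_map]
    congr 1
    refine Multiset.map_congr rfl fun η _ => ?_
    simp
    ring
  rw [hscale, Multiset.card_map] at h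
  intro h0
  apply mul_ne_zero hc h
  rw [← h0, Finset.mul_sum]
  refine Finset.sum_congr rfl fun j hj => ?_
  have e := congrArg (fun p => p.coeff j) hpoly
  simp only [coeff_binomialPoly, coeff_C_mul] at e
  rw [comp_C_mul_X_coeff]
  have := hch j hj
  field_simp
  linear_combination -a j * z ^ j * e

end HeilmannLieb

/-! ### Degrees and the partition function. -/

namespace HeilmannLieb

open Filter Topology

variable {α β : Type*} (G : Graph α β)

open Classical in
lemma deg_eq_sum_ite (H : Finset E(G)) (v : V(G)) :
    deg G H v = ∑ e ∈ H, ((if G.Inc e v then 1 else 0) + (if G.IsLoopAt e v then 1 else 0)) := by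
  -- In `deg`, the coercion of `H` to a finset of `β` is a monadic bind.
  have h : (do let a ← H; pure (a : β)) = H.map (Function.Embedding.subtype _) := by
    ext
    simp [Finset.bind_def, Finset.pure_def]
  rw [deg, h]
  simp only [Finset.card_filter, Finset.sum_map, Finset.sum_add_distrib]
  rfl

lemma deg_eq_sum (H : Finset E(G)) (v : V(G)) : deg G H v = ∑ e ∈ H, deg G {e} v := by
  classical
  simp only [deg_eq_sum_ite, Finset.sum_singleton]

lemma deg_mono {H H' : Finset E(G)} (h : H ⊆ H') (v : V(G)) : deg G H v ≤ deg G H' v := by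
  rw [deg_eq_sum, deg_eq_sum G H']
  exact Finset.sum_le_sum_of_subset h

open Classical in
-- The ends may coincide, so loops need no separate treatment later.
lemma exists_deg_singleton_eq (e : E(G)) :
    ∃ a b : V(G), ∀ v, deg G {e} v = (if v = a then 1 else 0) + (if v = b then 1 else 0) := by
  obtain ⟨a, b, hab⟩ := G.exists_isLink_of_mem_edgeSet e.2
  refine ⟨⟨a, hab.left_mem⟩, ⟨b, hab.right_mem⟩, fun v => ?_⟩
  have h1 : G.Inc e v ↔ (v : α) = a ∨ (v : α) = b := by
    refine ⟨fun h => h.eq_or_eq_of_isLink hab, ?_⟩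
    rintro (h | h) <;> rw [h]
    exacts [hab.inc_left, hab.inc_right]
  have h2 : G.IsLoopAt e v ↔ (v : α) = a ∧ (v : α) = b := by
    rw [← Graph.isLink_self_iff, hab.isLink_iff]
    grind
  simp only [deg_eq_sum_ite, Finset.sum_singleton, h1, h2, Subtype.ext_iff]
  split_ifs <;> simp_all

lemma exists_prod_pow_deg_singleton [Fintype V(G)] (e : E(G)) :
    ∃ a b : V(G), ∀ x : V(G) → ℂ, ∏ v, x v ^ deg G {e} v = x a * x b := by
  classical
  obtain ⟨a, b, h⟩ := exists_deg_singleton_eq G e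
  refine ⟨a, b, fun x => ?_⟩
  simp only [h, pow_add, Finset.prod_mul_distrib, pow_ite, pow_one, pow_zero]
  simp

/-- The handshake lemma. -/
lemma sum_deg_eq [Fintype V(G)] (H : Finset E(G)) : ∑ v, deg G H v = 2 * H.card := by
  classical
  simp only [deg_eq_sum G H]
  rw [Finset.sum_comm, Finset.sum_const_nat (m := 2), mul_comm]
  intro e _
  obtain ⟨a, b, h⟩ := exists_deg_singleton_eq G e
  simp [h, Finset.sum_add_distrib]

variable [Fintype E(G)]

lemma deg_le_degG (H : Finset E(G)) (v : V(G)) : deg G H v ≤ degG G v :=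
  deg_mono G (Finset.subset_univ H) v

section

variable [Fintype V(G)] (lam : E(G) → ℂ) (u : V(G) → ℕ → ℂ)

lemma eval_Z (x : V(G) → ℂ) :
    MvPolynomial.eval x (Z G lam u) = ∑ H : Finset E(G),
      ((∏ e ∈ H, lam e) * ∏ v, u v (deg G H v)) * ∏ v, x v ^ deg G H v := by
  simp [Z]

lemma eval_Z_one (x : V(G) → ℂ) :
    MvPolynomial.eval x (Z G lam fun _ _ => 1) =
      ∏ e, (1 + lam e * ∏ v, x v ^ deg G {e} v) := by
  rw [eval_Z, Finset.prod_one_add, Finset.powerset_univ]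
  refine Finset.sum_congr rfl fun H _ => ?_
  rw [Finset.prod_const_one, mul_one, Finset.prod_mul_distrib, Finset.prod_comm]
  congr 1
  refine Finset.prod_congr rfl fun v _ => ?_
  rw [Finset.prod_pow_eq_pow_sum, ← deg_eq_sum]

open Classical in
/-- The coefficient of `u_j x_v^j` in the partition function, as a function of the activities and
the variables at the other vertices. -/
noncomputable def vertexCoeff (x : V(G) → ℂ) (v : V(G)) (j : ℕ) : ℂ :=
  ∑ H : Finset E(G) with deg G H v = j,
    (∏ e ∈ H, lam e) * ∏ w ∈ Finset.univ.erase v, u w (deg G H w) * x w ^ deg G H w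

lemma eval_Z_eq_sum_vertexCoeff (x : V(G) → ℂ) (v : V(G)) :
    MvPolynomial.eval x (Z G lam u) =
      ∑ j ∈ Finset.range (degG G v + 1), vertexCoeff G lam u x v j * u v j * x v ^ j := by
  classical
  rw [eval_Z, ← Finset.sum_fiberwise_of_maps_to (g := fun H => deg G H v)
    (t := Finset.range (degG G v + 1))
    fun H _ => Finset.mem_range.2 (Nat.lt_succ_of_le (deg_le_degG G H v))]
  refine Finset.sum_congr rfl fun j _ => ?_
  rw [vertexCoeff, Finset.sum_mul, Finset.sum_mul]
  refine Finset.sum_congr rfl fun H hH => ?_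
  have hj : deg G H v = j := (Finset.mem_filter.1 hH).2
  rw [mul_assoc, ← Finset.prod_mul_distrib, ← Finset.mul_prod_erase _ _ (Finset.mem_univ v), hj]
  ring

/-- Allows the activities and the variable at `v` to change with the coefficients fixed. -/
lemma vertexCoeff_congr {u u' : V(G) → ℕ → ℂ} {x x' : V(G) → ℂ} {v : V(G)}
    (hu : ∀ w ≠ v, u w = u' w) (hx : ∀ w ≠ v, x w = x' w) (j : ℕ) :
    vertexCoeff G lam u x v j = vertexCoeff G lam u' x' v j := by
  classical
  refine Finset.sum_congr rfl fun H _ => ?_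
  congr 1
  refine Finset.prod_congr rfl fun w hw => ?_
  rw [hu w (Finset.ne_of_mem_erase hw), hx w (Finset.ne_of_mem_erase hw)]

/-- Two numbers in the open right half-plane never have a product on the negative real axis. -/
lemma one_add_mul_mul_ne_zero {l : ℝ} (hl : 0 ≤ l) {z w : ℂ} (hz : 0 < z.re) (hw : 0 < w.re) :
    1 + (l : ℂ) * (z * w) ≠ 0 := by
  intro h
  have hre := congrArg Complex.re h
  have him := congrArg Complex.im h
  simp at hre him
  rcases him with rfl | him
  · simp at hre
  · have h1 : z.re * (z.re * w.re - z.im * w.im) = w.re * (z.re ^ 2 + z.im ^ 2) := by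
      linear_combination -z.im * him
    have h2 : 0 < z.re * (z.re * w.re - z.im * w.im) := by
      rw [h1]
      positivity
    have h3 := pos_of_mul_pos_right h2 hz.le
    have := mul_nonneg hl h3.le
    linarith

lemma eval_Z_ne_zero_of_admissible {lam : E(G) → ℝ} (hlam : ∀ e, 0 ≤ lam e)
    {u : V(G) → ℕ → ℂ} (hu : ∀ v, Admissible (degG G v) (u v)) {x : V(G) → ℂ}
    (hx : ∀ v, x v ∈ sector (Real.pi / 6)) :
    MvPolynomial.eval x (Z G (fun e => (lam e : ℂ)) u) ≠ 0 := by
  classical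
  -- `W` is the set of vertices with activities switched on; the other variables still range over
  -- the whole half-plane.
  have key : ∀ (W : Finset V(G)) (x : V(G) → ℂ), (∀ v ∈ W, x v ∈ sector (Real.pi / 6)) →
      (∀ v ∉ W, 0 < (x v).re) → MvPolynomial.eval x (Z G (fun e => (lam e : ℂ))
        fun v => if v ∈ W then u v else fun _ => 1) ≠ 0 := by
    intro W
    induction W using Finset.induction_on with
    | empty =>
      intro x _ hx
      simp only [Finset.notMem_empty, if_false]
      rw [eval_Z_one, Finset.prod_ne_zero_iff]
      intro e _
      obtain ⟨a, b, h⟩ := exists_prod_pow_deg_singleton G e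
      rw [h]
      exact one_add_mul_mul_ne_zero (hlam e) (hx a (Finset.notMem_empty a))
        (hx b (Finset.notMem_empty b))
    | insert v W hv ih =>
      intro x hxW hx
      rw [eval_Z_eq_sum_vertexCoeff G _ _ x v]
      simp only [Finset.mem_insert_self, if_true]
      refine sum_activity_ne_zero (hu v) (fun t ht => ?_) (hxW v (Finset.mem_insert_self v W))
      have h := ih (Function.update x v t) ?_ ?_
      · rw [eval_Z_eq_sum_vertexCoeff G _ _ _ v] at h
        simp only [if_neg hv, Function.update_self, mul_one] at h
        convert! h using 3
        refine vertexCoeff_congr G _ (fun w hw => ?_) (fun w hw => ?_) _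
        · simp [Finset.mem_insert, hw]
        · rw [Function.update_of_ne hw]
      · intro w hw
        rw [Function.update_of_ne (by rintro rfl; exact hv hw)]
        exact hxW w (Finset.mem_insert_of_mem hw)
      · intro w hw
        by_cases hwv : w = v
        · rw [hwv, Function.update_self]
          exact ht
        · rw [Function.update_of_ne hwv]
          exact hx w (by simp [hwv, hw])
  simpa using key Finset.univ x (fun v _ => hx v) (by simp)

/-- The partition function along the complex line `t ↦ z + t y`. -/
lemma exists_polynomial_eval_line (z y : V(G) → ℂ) :
    ∃ q : Polynomial ℂ, q.natDegree ≤ ∑ v, degG G v ∧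
      ∀ t, q.eval t = MvPolynomial.eval (fun v => z v + y v * t) (Z G lam u) := by
  refine ⟨∑ H : Finset E(G), Polynomial.C ((∏ e ∈ H, lam e) * ∏ v, u v (deg G H v)) *
    ∏ v, (Polynomial.C (z v) + Polynomial.C (y v) * Polynomial.X) ^ deg G H v, ?_, ?_⟩
  · refine Polynomial.natDegree_sum_le_of_forall_le _ _ fun H _ => ?_
    refine (Polynomial.natDegree_C_mul_le _ _).trans ((Polynomial.natDegree_prod_le _ _).trans ?_)
    refine Finset.sum_le_sum fun v _ => ?_
    refine (Polynomial.natDegree_pow_le_of_le (m := 1) _ ?_).trans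
      ((mul_one _).trans_le (deg_le_degG G H v))
    compute_degree
  · intro t
    rw [eval_Z, Polynomial.eval_finsetSum]
    simp [Polynomial.eval_prod]

/-- Hurwitz's theorem for the partition function, as a function of the activities. -/
lemma mvNonvanishing_Z_of_tendsto {U : ℝ → V(G) → ℕ → ℂ}
    (hU : ∀ ε, 0 < ε → ∀ x : V(G) → ℂ, (∀ v, x v ∈ sector (Real.pi / 6)) →
      MvPolynomial.eval x (Z G lam (U ε)) ≠ 0)
    (hlim : ∀ v, ∀ j ≤ degG G v, Tendsto (fun ε => U ε v j) (𝓝[>] 0) (𝓝 (u v j))) :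
    MvNonvanishing (sector (Real.pi / 6)) (Z G lam u) := by
  by_contra hcon
  rw [MvNonvanishing, not_or] at hcon
  obtain ⟨hne, hz⟩ := hcon
  push Not at hz
  obtain ⟨z, hzS, hz0⟩ := hz
  obtain ⟨w, hw⟩ : ∃ w : V(G) → ℂ, MvPolynomial.eval w (Z G lam u) ≠ 0 := by
    by_contra! h
    exact hne (MvPolynomial.funext fun x => by rw [h x, map_zero])
  -- On the line from the zero `z` (`t = 0`) to `w` (`t = 1`), a disc about `0` of radius
  -- independent of `ε` stays in the sector. The bound at `t = 1` is therefore uniform, and its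
  -- limit forces `Z` to vanish at `w`.
  have hopen : IsOpen {t : ℂ | ∀ v, z v + (w v - z v) * t ∈ sector (Real.pi / 6)} := by
    have : {t : ℂ | ∀ v, z v + (w v - z v) * t ∈ sector (Real.pi / 6)} =
        ⋂ v, (fun t => z v + (w v - z v) * t) ⁻¹' sector (Real.pi / 6) := by
      ext
      simp
    rw [this]
    exact isOpen_iInter_of_finite fun v => isOpen_sector_pi_div_six.preimage (by fun_prop)
  obtain ⟨r, hr, hball⟩ := Metric.isOpen_iff.1 hopen 0 (by simpa using hzS)
  have hbound : ∀ ε, 0 < ε → ‖MvPolynomial.eval w (Z G lam (U ε))‖ ≤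
      ‖MvPolynomial.eval z (Z G lam (U ε))‖ * (1 + ‖(1 : ℂ)‖ / r) ^ ∑ v, degG G v := by
    intro ε hε
    obtain ⟨q, hq, hqe⟩ := exists_polynomial_eval_line G lam (U ε) z fun v => w v - z v
    have := norm_eval_le_of_ne_zero hq hr (fun t ht => by
      rw [hqe]
      exact hU ε hε _ (hball (by simpa using ht))) 1
    simpa [hqe] using this
  have hconv : ∀ x : V(G) → ℂ, Tendsto (fun ε => MvPolynomial.eval x (Z G lam (U ε))) (𝓝[>] 0)
      (𝓝 (MvPolynomial.eval x (Z G lam u))) := by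
    intro x
    simp only [eval_Z]
    refine tendsto_finsetSum _ fun H _ => ?_
    refine (Tendsto.const_mul _ (tendsto_finsetProd _ fun v _ => ?_)).mul_const _
    exact hlim v _ (deg_le_degG G H v)
  have hle := le_of_tendsto_of_tendsto (hconv w).norm ((hconv z).norm.mul_const _)
    (eventually_nhdsWithin_of_forall hbound)
  rw [hz0, norm_zero, zero_mul] at hle
  exact hw (norm_le_zero_iff.1 hle)

end

/-! ### Square roots and the three assertions. -/

lemma sqrt_mem_sector {θ : ℝ} {y : ℂ} (hy : y ∈ sector θ) :
    ∃ s ∈ sector (θ / 2), s ^ 2 = y := by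
  obtain ⟨hy, ha⟩ := hy
  refine ⟨Complex.exp (Complex.log y / 2), ⟨Complex.exp_ne_zero _, ?_⟩, ?_⟩
  · have him : (Complex.log y / 2).im = y.arg / 2 := by
      rw [Complex.div_ofNat_im, Complex.log_im]
    have h1 := Complex.neg_pi_lt_arg y
    have h2 := Complex.arg_le_pi y
    have hpi := Real.pi_pos
    rw [Complex.arg_exp, him, toIocMod_eq_self _ |>.2]
    · rw [abs_div, abs_two]
      linarith
    · constructor <;> linarith
  · rw [← Complex.exp_nat_mul]
    convert! Complex.exp_log hy using 2
    push_cast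
    ring

lemma key_intervalActivity_nonvanishing {f g : V(G) → ℕ} (hfg : ∀ v, f v ≤ g v)
    (hgf : ∀ v, g v ≤ f v + 2) (v : V(G)) :
    Nonvanishing (sector (2 * Real.pi / 3)) (key G (intervalActivity f g) v) := by
  by_cases hd : f v ≤ degG G v
  · right
    obtain ⟨c, s, hc, -, hs, hpoly⟩ := binomialPoly_interval_eq hd (hfg v) (hgf v)
    intro z hz
    rw [show key G (intervalActivity f g) v = _ from hpoly, Polynomial.eval_mul,
      Polynomial.eval_mul, Polynomial.eval_C, Polynomial.eval_pow, Polynomial.eval_X,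
      Polynomial.eval_multiset_prod, Multiset.map_map]
    refine mul_ne_zero (mul_ne_zero hc (pow_ne_zero _ hz.1)) (Multiset.prod_ne_zero ?_)
    intro h0
    obtain ⟨η, hη, h⟩ := Multiset.mem_map.1 h0
    refine one_add_mul_ne_zero_of_mem_cone hz (hs η hη) ?_
    simpa using h
  · left
    refine Finset.sum_eq_zero fun j hj => ?_
    rw [Finset.mem_range] at hj
    have : intervalActivity f g v j = 0 := if_neg (by omega)
    rw [this, mul_zero, Polynomial.C_0, zero_mul]

lemma Z_intervalActivity_nonvanishing [Fintype V(G)] {lam : E(G) → ℝ} (hlam : ∀ e, 0 ≤ lam e)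
    {f g : V(G) → ℕ} (hfg : ∀ v, f v ≤ g v) (hgf : ∀ v, g v ≤ f v + 2) :
    MvNonvanishing (sector (Real.pi / 6))
      (Z G (fun e => (lam e : ℂ)) (intervalActivity f g)) := by
  -- If `f v` exceeds the degree of `v`, no `H` contributes and `Z` is identically zero.
  by_cases hd : ∀ v, f v ≤ degG G v
  · choose U hU hlim using fun v => exists_admissible_tendsto (hd v) (hfg v) (hgf v)
    exact mvNonvanishing_Z_of_tendsto G _ _ (U := fun ε v => U v ε)
      (fun ε hε x hx => eval_Z_ne_zero_of_admissible G hlam (fun v => hU v ε hε) hx) hlim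
  · push Not at hd
    obtain ⟨v, hv⟩ := hd
    refine Or.inl (Finset.sum_eq_zero fun H _ => ?_)
    rw [Finset.prod_eq_zero (i := v) (Finset.mem_univ v) (f := fun v =>
      intervalActivity f g v (deg G H v)), mul_zero, MvPolynomial.C_0, zero_mul]
    have := deg_le_degG G H v
    exact if_neg (by omega)

/-- On the diagonal the partition function is a polynomial in the square of the variable. -/
lemma exists_polynomial_eval_sq [Fintype V(G)] (lam : E(G) → ℂ) (u : V(G) → ℕ → ℂ) :
    ∃ Q : Polynomial ℂ, ∀ s y : ℂ, s ^ 2 = y →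
      Q.eval y = MvPolynomial.eval (fun _ => s) (Z G lam u) := by
  refine ⟨∑ H : Finset E(G), Polynomial.C ((∏ e ∈ H, lam e) * ∏ v, u v (deg G H v)) *
    Polynomial.X ^ H.card, ?_⟩
  rintro s _ rfl
  rw [eval_Z, Polynomial.eval_finsetSum]
  refine Finset.sum_congr rfl fun H _ => ?_
  rw [Finset.prod_pow_eq_pow_sum, sum_deg_eq, Polynomial.eval_mul, Polynomial.eval_C,
    Polynomial.eval_pow, Polynomial.eval_X, pow_mul]

/-- Passing from the variable to its square doubles the angle of the zero-free sector. -/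
lemma nonvanishing_of_eval_sq {σ : Type*} {θ : ℝ} {F : MvPolynomial σ ℂ} {Q : Polynomial ℂ}
    (hQ : ∀ s y : ℂ, s ^ 2 = y → Q.eval y = MvPolynomial.eval (fun _ => s) F)
    (hF : MvNonvanishing (sector (θ / 2)) F) : Nonvanishing (sector θ) Q := by
  rcases hF with h0 | hne
  · left
    refine Polynomial.funext fun y => ?_
    obtain ⟨s, hs⟩ := IsAlgClosed.exists_pow_nat_eq y two_pos
    rw [hQ s y hs, h0, map_zero, Polynomial.eval_zero]
  · right
    intro y hy
    obtain ⟨s, hs, hsy⟩ := sqrt_mem_sector hy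
    rw [hQ s y hsy]
    exact hne _ fun _ => hs

end HeilmannLieb

theorem mainTheorem6 {α β : Type*} (G : Graph α β) [Fintype V(G)] [Fintype E(G)]
    (lam : E(G) → ℝ) (hlam : ∀ e, 0 ≤ lam e)
    (f g : V(G) → ℕ) (hfg : ∀ v, f v ≤ g v) (hgf : ∀ v, g v ≤ f v + 2) :
    (∀ v : V(G), HeilmannLieb.Nonvanishing (HeilmannLieb.sector (2 * Real.pi / 3))
      (HeilmannLieb.key G (HeilmannLieb.intervalActivity f g) v)) ∧
    HeilmannLieb.MvNonvanishing (HeilmannLieb.sector (Real.pi / 6))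
      (HeilmannLieb.Z G (fun e => (lam e : ℂ)) (HeilmannLieb.intervalActivity f g)) ∧
    -- `Q(y) = Z(G, λ, u; y^{1/2} 1)`, for either choice `s` of the square root of `y`
    ∃ Q : Polynomial ℂ,
      (∀ s y : ℂ, s ^ 2 = y → Q.eval y = MvPolynomial.eval (fun _ => s)
        (HeilmannLieb.Z G (fun e => (lam e : ℂ)) (HeilmannLieb.intervalActivity f g))) ∧
      HeilmannLieb.Nonvanishing (HeilmannLieb.sector (Real.pi / 3)) Q := by
  have hZ := HeilmannLieb.Z_intervalActivity_nonvanishing G hlam hfg hgf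
  obtain ⟨Q, hQ⟩ := HeilmannLieb.exists_polynomial_eval_sq G (fun e => (lam e : ℂ))
    (HeilmannLieb.intervalActivity f g)
  refine ⟨HeilmannLieb.key_intervalActivity_nonvanishing G hfg hgf, hZ, Q, hQ,
    HeilmannLieb.nonvanishing_of_eval_sq hQ ?_⟩
  rwa [show Real.pi / 3 / 2 = Real.pi / 6 by ring]
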